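/- Let $W$ be a complex vector space of dimension $N+1$ and let $V\subset\mathbb P^N=\mathbb P W$ be a smooth irreducible closed subvariety. Let $Y=SV$ be its secant variety, i.e. the Zariski closure of the union of all lines in $\mathbb P^N$ joining two distinct points of $V$. For a closed subvariety $X\subset\mathbb P W$ (with its reduced structure), denote by $\hat X\subset W$ its affine cone, by $\operatorname{Sm}\hat X$ the set of smooth points of $\hat X$, by $T_{\hat X,x}\subset W$ the tangent space of $\hat X$ at $x$, and put $$\mathfrak{aut}\,\hat X=\{g\in\mathfrak{gl}\,W \mid g(x)\in T_{\hat X,x}\ \text{ for all } x\in\operatorname{Sm}\hat X\},$$ $$\mathfrak{aut}^1\hat X=\{A\in\operatorname{Hom}(\operatorname{Sym}^2W,W)\mid A(w,\cdot)\in\mathfrak{aut}\,\hat X\ \text{ for all } w\in W\}.$$ Suppose that $V$ is an irreducible component of the singular locus $Y'=\operatorname{Sing}Y$. Then $$\mathfrak{aut}\,\hat Y=\mathfrak{aut}\,\hat V\qquad\text{and}\qquad \mathfrak{aut}^1\hat Y=\mathfrak{aut}^1\hat V.$$ -/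

import Mathlib

open scoped LinearAlgebra.Projectivization

noncomputable section

namespace SecantAut

/-- The complex vector space `W` of dimension `N + 1`, in coordinates. -/
abbrev W (N : ℕ) : Type := Fin (N + 1) → ℂ

/-- The projective space `ℙ^N = ℙ W` of lines in `W`. -/
abbrev PSpace (N : ℕ) : Type := ℙ ℂ (W N)

/-- The common zero locus in `ℙ^N` of a set of polynomials: the points all of whose homogeneous
coordinate vectors are zeros of every polynomial of the set. -/
def projZeroLocus (N : ℕ) (S : Set (MvPolynomial (Fin (N + 1)) ℂ)) : Set (PSpace N) :=
  {p | ∀ f ∈ S, ∀ (w : W N) (hw : w ≠ 0), Projectivization.mk ℂ w hw = p →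
    MvPolynomial.eval w f = 0}

/-- A subset of `ℙ^N` is Zariski closed if it is cut out by homogeneous polynomials. -/
def IsAlgebraicSet {N : ℕ} (V : Set (PSpace N)) : Prop :=
  ∃ S : Set (MvPolynomial (Fin (N + 1)) ℂ),
    (∀ f ∈ S, ∃ d : ℕ, f.IsHomogeneous d) ∧ V = projZeroLocus N S

lemma eval_eq_zero_iff_of_mk_eq {N : ℕ} {f : MvPolynomial (Fin (N + 1)) ℂ} {d : ℕ}
    (hf : f.IsHomogeneous d) {v w : W N} (hv : v ≠ 0) (hw : w ≠ 0)
    (h : Projectivization.mk ℂ v hv = Projectivization.mk ℂ w hw) :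
    MvPolynomial.eval v f = 0 ↔ MvPolynomial.eval w f = 0 := by
  obtain ⟨a, rfl⟩ := (Projectivization.mk_eq_mk_iff ℂ v w hv hw).1 h
  have : MvPolynomial.eval (a • w) f = (a : ℂ) ^ d * MvPolynomial.eval w f := by
    rw [MvPolynomial.eval_eq, MvPolynomial.eval_eq, Finset.mul_sum]
    refine Finset.sum_congr rfl fun m hm => ?_
    have hd : ∑ i ∈ m.support, m i = d := by
      have := hf (MvPolynomial.mem_support_iff.1 hm)
      rwa [Finsupp.weight_apply, Finsupp.sum, Finset.sum_congr rfl (g := fun i => m i)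
        (by simp)] at this
    simp only [Pi.smul_apply, Units.smul_def, smul_eq_mul, mul_pow, Finset.prod_mul_distrib,
      Finset.prod_pow_eq_pow_sum, hd]
    ring
  simp [this]

/-- The Zariski topology on `ℙ^N`. -/
instance zariskiTopology (N : ℕ) : TopologicalSpace (PSpace N) :=
  TopologicalSpace.ofClosed {V | IsAlgebraicSet V}
    (by
      refine ⟨{1}, ?_, ?_⟩
      · rintro f rfl
        exact ⟨0, MvPolynomial.isHomogeneous_one _ _⟩
      · ext p
        simp only [Set.mem_empty_iff_false, projZeroLocus, Set.mem_ofPred_eq, false_iff]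
        intro h
        simpa using h 1 rfl p.rep p.rep_nonzero p.mk_rep)
    (by
      intro A hA
      have hA' : ∀ V ∈ A, IsAlgebraicSet V := hA
      choose! S hS hV using hA'
      refine ⟨⋃ V ∈ A, S V, ?_, ?_⟩
      · intro f hf
        simp only [Set.mem_iUnion] at hf
        obtain ⟨V, hVA, hf⟩ := hf
        exact hS V hVA f hf
      · ext p
        simp only [Set.mem_sInter, projZeroLocus, Set.mem_iUnion, Set.mem_ofPred_eq]
        constructor
        · rintro h f ⟨V, hVA, hf⟩
          have := h V hVA
          rw [hV V hVA] at this
          exact this f hf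
        · intro h V hVA
          rw [hV V hVA]
          exact fun f hf => h f ⟨V, hVA, hf⟩)
    (by
      rintro _ ⟨S, hS, rfl⟩ _ ⟨T, hT, rfl⟩
      refine ⟨{h | ∃ f ∈ S, ∃ g ∈ T, h = f * g}, ?_, ?_⟩
      · rintro _ ⟨f, hf, g, hg, rfl⟩
        obtain ⟨d, hd⟩ := hS f hf
        obtain ⟨e, he⟩ := hT g hg
        exact ⟨d + e, hd.mul he⟩
      · ext p
        constructor
        · rintro (h | h) _ ⟨f, hf, g, hg, rfl⟩ w hw hp
          · simp [h f hf w hw hp]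
          · simp [h g hg w hw hp]
        · intro h
          by_contra hcon
          simp only [Set.mem_union, not_or, projZeroLocus, Set.mem_ofPred_eq, not_forall] at hcon
          obtain ⟨⟨f, hf, v, hv, hvp, hfv⟩, ⟨g, hg, w, hw, hwp, hgw⟩⟩ := hcon
          obtain ⟨d, hd⟩ := hS f hf
          have h1 := h (f * g) ⟨f, hf, g, hg, rfl⟩ w hw hwp
          rw [map_mul, mul_eq_zero] at h1
          rcases h1 with h1 | h1
          · exact hfv ((eval_eq_zero_iff_of_mk_eq hd hv hw (hvp.trans hwp.symm)).2 h1)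
          · exact hgw h1)

lemma isClosed_iff_isAlgebraicSet {N : ℕ} (V : Set (PSpace N)) :
    IsClosed V ↔ IsAlgebraicSet V := by
  rw [← isOpen_compl_iff]
  change Vᶜᶜ ∈ {V | IsAlgebraicSet V} ↔ _
  simp

/-- The affine cone in `W` over a subset `X` of `ℙ^N`: the union of `{0}` and of all the lines
that are points of `X`. -/
def cone {N : ℕ} (X : Set (PSpace N)) : Set (W N) :=
  {w | ∀ hw : w ≠ 0, Projectivization.mk ℂ w hw ∈ X}

/-- The coordinate ring `ℂ[W] / I(X)` of a closed subset `X` of the affine space `W`, with its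
reduced structure. -/
abbrev CoordRing {N : ℕ} (X : Set (W N)) : Type :=
  MvPolynomial (Fin (N + 1)) ℂ ⧸ MvPolynomial.vanishingIdeal ℂ X

/-- `x` is a smooth point of the (reduced) affine variety `X ⊆ W`: the maximal ideal of `x` in the
coordinate ring of `X` lies in the smooth locus of that ring over `ℂ`. -/
def IsSmoothPoint {N : ℕ} (X : Set (W N)) (x : W N) : Prop :=
  ∃ p : PrimeSpectrum (CoordRing X),
    PrimeSpectrum.comap (Ideal.Quotient.mk (MvPolynomial.vanishingIdeal ℂ X)) p =
      MvPolynomial.pointToPoint x ∧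
    p ∈ Algebra.smoothLocus ℂ (CoordRing X)

/-- The smooth locus `Sm X` of an affine variety `X ⊆ W`. -/
def smoothPoints {N : ℕ} (X : Set (W N)) : Set (W N) :=
  {x | x ∈ X ∧ IsSmoothPoint X x}

/-- The singular locus (with its reduced structure) of a projective variety `Y ⊆ ℙ^N`: the points
of `Y` over which the affine cone of `Y` is singular. -/
def singularLocus {N : ℕ} (Y : Set (PSpace N)) : Set (PSpace N) :=
  {p | p ∈ Y ∧ ∃ (w : W N) (hw : w ≠ 0), Projectivization.mk ℂ w hw = p ∧
    w ∉ smoothPoints (cone Y)}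

/-- The line in `ℙ^N` through the (distinct) points `p` and `q`. -/
def line {N : ℕ} (p q : PSpace N) : Set (PSpace N) :=
  {r | r.submodule ≤ p.submodule ⊔ q.submodule}

/-- The secant variety `SV`: the Zariski closure of the union of all lines that join two distinct
points of `V`. -/
def secantVariety {N : ℕ} (V : Set (PSpace N)) : Set (PSpace N) :=
  closure {r | ∃ p ∈ V, ∃ q ∈ V, p ≠ q ∧ r ∈ line p q}

/-- `V` is an irreducible component of `Z ⊆ ℙ^N`, that is, a maximal irreducible subset of `Z`. -/
def IsIrredComponentOf {N : ℕ} (V Z : Set (PSpace N)) : Prop :=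
  Maximal (fun T => IsIrreducible T ∧ T ⊆ Z) V

/-- The (embedded) Zariski tangent space of an affine variety `X ⊆ W` at `x`: the vectors `v` with
`d_x f (v) = 0` for every polynomial `f` that vanishes on `X`. -/
def tangentSpace {N : ℕ} (X : Set (W N)) (x : W N) : Submodule ℂ (W N) where
  carrier := {v | ∀ f ∈ MvPolynomial.vanishingIdeal ℂ X,
    ∑ i, MvPolynomial.eval x (MvPolynomial.pderiv i f) * v i = 0}
  zero_mem' := by simp
  add_mem' := by
    intro u v hu hv f hf
    simp [mul_add, Finset.sum_add_distrib, hu f hf, hv f hf]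
  smul_mem' := by
    intro c v hv f hf
    have := hv f hf
    simp only [Pi.smul_apply, smul_eq_mul, mul_left_comm _ c, ← Finset.mul_sum, this, mul_zero]

/-- The Lie algebra `aut X ⊆ gl W` of infinitesimal linear automorphisms of `X ⊆ W`: the
endomorphisms `g` with `g y ∈ T_{X, y}` for all smooth points `y` of `X`. -/
def aut {N : ℕ} (X : Set (W N)) : Submodule ℂ (Module.End ℂ (W N)) where
  carrier := {g | ∀ y ∈ smoothPoints X, g y ∈ tangentSpace X y}
  zero_mem' := fun _ _ => Submodule.zero_mem _
  add_mem' := fun hg hh y hy => Submodule.add_mem _ (hg y hy) (hh y hy)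
  smul_mem' := fun c _ hg y hy => Submodule.smul_mem _ c (hg y hy)

/-- The space `𝔤¹` of prolongations of a subspace `𝔤 ⊆ gl W`: the symmetric bilinear maps
`A : W × W → W`, that is, the elements of `Hom(Sym² W, W)`, with `A(w, ·) ∈ 𝔤` for all `w`. -/
def prolongation {N : ℕ} (𝔤 : Submodule ℂ (Module.End ℂ (W N))) :
    Submodule ℂ (W N →ₗ[ℂ] W N →ₗ[ℂ] W N) where
  carrier := {A | (∀ u w, A u w = A w u) ∧ ∀ w, A w ∈ 𝔤}
  zero_mem' := ⟨fun _ _ => rfl, fun _ => Submodule.zero_mem _⟩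
  add_mem' := fun hA hB =>
    ⟨fun u w => by simp [hA.1 u w, hB.1 u w], fun w => Submodule.add_mem _ (hA.2 w) (hB.2 w)⟩
  smul_mem' := fun c _ hA =>
    ⟨fun u w => by simp [hA.1 u w], fun w => Submodule.smul_mem _ c (hA.2 w)⟩

end SecantAut

end

namespace SecantAut

open MvPolynomial

variable {N : ℕ}

/-! An endomorphism `g` acts on polynomials as the derivation `linearDerivation g`, whose value on
`f` at `x` is `d_x f (g x)`. Smooth points are dense, so for a closed cone `g ∈ aut X` means that
this derivation preserves the ideal of `X`.

From `Y` to `V`: the flow `exp (t g)` preserves the cone over `Y` (`flow_mem_cone`). It consists of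
linear automorphisms, so it also preserves the singular locus (`flow_mem_cone_singularLocus`).
Differentiating at `t = 0`, the derivation preserves the ideal of the singular locus, hence by the
Leibniz rule that of its component `V` (`linearDerivation_mem_of_isIrredComponentOf`).

From `V` to `Y`: if `f` vanishes on the cone over `Y` and `v` lies on the cone over `V`, then `f (·
+ v)` vanishes on the cone over `V`, so `d_{u+v} f (g u) = 0`. Exchanging `u` and `v` and adding
gives tangency at `u + v`, and such sums are dense in the cone over `Y`
(`linearDerivation_mem_secantVariety`).

The prolongation depends on `aut` alone, so the second equality follows from the first. -/

lemma mem_vanishingIdeal_iff_eval {X : Set (W N)} {f : MvPolynomial (Fin (N + 1)) ℂ} :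
    f ∈ vanishingIdeal ℂ X ↔ ∀ x ∈ X, eval x f = 0 := by
  simp [mem_vanishingIdeal_iff, aeval_eq_eval]

/-! ### Cones -/

lemma mk_mem_iff_mem_cone {X : Set (PSpace N)} {w : W N} (hw : w ≠ 0) :
    Projectivization.mk ℂ w hw ∈ X ↔ w ∈ cone X :=
  ⟨fun h _ => h, fun h => h hw⟩

lemma zero_mem_cone (X : Set (PSpace N)) : (0 : W N) ∈ cone X := fun h => absurd rfl h

lemma smul_mem_cone {X : Set (PSpace N)} {w : W N} (hw : w ∈ cone X) (c : ℂ) :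
    c • w ∈ cone X := by
  intro h
  have hc : c ≠ 0 := fun hc => h (by simp [hc])
  have hw0 : w ≠ 0 := fun hw => h (by simp [hw])
  convert! hw hw0 using 1
  exact (Projectivization.mk_eq_mk_iff ℂ _ _ _ _).2 ⟨Units.mk0 c hc, rfl⟩

lemma cone_mono {X Z : Set (PSpace N)} (h : X ⊆ Z) : cone X ⊆ cone Z :=
  fun _ hw hw0 => h (hw hw0)

lemma cone_injective : Function.Injective (cone : Set (PSpace N) → Set (W N)) := by
  intro X Z h
  ext p
  rw [← p.mk_rep, mk_mem_iff_mem_cone, mk_mem_iff_mem_cone, h]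

lemma mem_cone_of_mem_submodule {X : Set (PSpace N)} {p : PSpace N} (hp : p ∈ X) {w : W N}
    (hw : w ∈ p.submodule) : w ∈ cone X := by
  rw [p.submodule_eq, Submodule.mem_span_singleton] at hw
  obtain ⟨c, rfl⟩ := hw
  exact smul_mem_cone (fun _ => by rwa [p.mk_rep]) c

lemma eval_smul_of_isHomogeneous {f : MvPolynomial (Fin (N + 1)) ℂ} {d : ℕ}
    (hf : f.IsHomogeneous d) (c : ℂ) (w : W N) : eval (c • w) f = c ^ d * eval w f := by
  rw [eval_eq, eval_eq, Finset.mul_sum]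
  refine Finset.sum_congr rfl fun m hm => ?_
  have hd : ∑ i ∈ m.support, m i = d := by
    have := hf (mem_support_iff.1 hm)
    rwa [Finsupp.weight_apply, Finsupp.sum, Finset.sum_congr rfl (g := fun i => m i)
      (by simp)] at this
  simp only [Pi.smul_apply, smul_eq_mul, mul_pow, Finset.prod_mul_distrib,
    Finset.prod_pow_eq_pow_sum, hd]
  ring

/-- As a function of `c`, `f (c • w)` is a polynomial whose coefficients are the values at `w` of
the homogeneous components of `f`. -/
lemma eval_homogeneousComponent_eq_zero {f : MvPolynomial (Fin (N + 1)) ℂ} {w : W N}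
    (h : ∀ c : ℂ, eval (c • w) f = 0) (n : ℕ) : eval w (homogeneousComponent n f) = 0 := by
  set P : Polynomial ℂ := ∑ k ∈ Finset.range (f.totalDegree + 1),
    Polynomial.C (eval w (homogeneousComponent k f)) * Polynomial.X ^ k with hP
  have hP0 : P = 0 := by
    refine Polynomial.funext fun c => ?_
    rw [Polynomial.eval_zero, ← h c]
    conv_rhs => rw [← sum_homogeneousComponent f]
    simp only [hP, Polynomial.eval_finsetSum, map_sum, Polynomial.eval_mul, Polynomial.eval_C,
      Polynomial.eval_pow, Polynomial.eval_X]
    exact Finset.sum_congr rfl fun k _ => by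
      rw [eval_smul_of_isHomogeneous (homogeneousComponent_isHomogeneous k f), mul_comm]
  have hc : P.coeff n = 0 := by rw [hP0, Polynomial.coeff_zero]
  rw [hP, Polynomial.finsetSum_coeff] at hc
  simp only [Polynomial.coeff_C_mul, Polynomial.coeff_X_pow, mul_ite, mul_one, mul_zero,
    Finset.sum_ite_eq, Finset.mem_range] at hc
  split_ifs at hc with hn
  · exact hc
  · rw [homogeneousComponent_eq_zero n f (by omega), map_zero]

/-- This makes density arguments available for inhomogeneous `f`: on a cone all homogeneous
components of `f` vanish, and together they cut out a closed set containing `T`. -/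
lemma eval_eq_zero_of_mem_cone_closure {T : Set (PSpace N)} {f : MvPolynomial (Fin (N + 1)) ℂ}
    (hf : ∀ w ∈ cone T, eval w f = 0) {w : W N} (hw : w ∈ cone (closure T)) :
    eval w f = 0 := by
  rcases eq_or_ne w 0 with rfl | hw0
  · exact hf 0 (zero_mem_cone T)
  have hcl : IsClosed (projZeroLocus N (Set.range fun n => homogeneousComponent n f)) := by
    rw [isClosed_iff_isAlgebraicSet]
    refine ⟨_, ?_, rfl⟩
    rintro _ ⟨n, rfl⟩
    exact ⟨n, homogeneousComponent_isHomogeneous n f⟩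
  have hsub : T ⊆ projZeroLocus N (Set.range fun n => homogeneousComponent n f) := by
    rintro p hp _ ⟨n, rfl⟩ v hv rfl
    exact eval_homogeneousComponent_eq_zero
      (fun c => hf _ (smul_mem_cone (fun _ => hp) c)) n
  have := closure_minimal hsub hcl (hw hw0)
  rw [← sum_homogeneousComponent f, map_sum]
  exact Finset.sum_eq_zero fun n _ => this _ ⟨n, rfl⟩ w hw0 rfl

lemma zeroLocus_vanishingIdeal_cone {X : Set (PSpace N)} (hX : IsClosed X) :
    zeroLocus ℂ (vanishingIdeal ℂ (cone X)) = cone X := by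
  refine (Set.Subset.antisymm ?_ (zeroLocus_vanishingIdeal_le _))
  obtain ⟨S, hS, rfl⟩ := (isClosed_iff_isAlgebraicSet X).1 hX
  intro x hx hx0 f hf w hw hwx
  obtain ⟨d, hd⟩ := hS f hf
  rw [eval_eq_zero_iff_of_mk_eq hd hw hx0 hwx]
  obtain ⟨i, hi⟩ : ∃ i, x i ≠ 0 := Function.ne_iff.1 hx0
  -- A defining equation of degree 0 need not vanish at the vertex of the cone. The factor `X i`
  -- forces vanishing there, and it can be cancelled at `x` because `x i ≠ 0`.
  have hmem : X i * f ∈ vanishingIdeal ℂ (cone (projZeroLocus N S)) := by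
    rw [mem_vanishingIdeal_iff_eval]
    intro v hv
    rcases eq_or_ne v 0 with rfl | hv0
    · simp
    · rw [map_mul, hv hv0 f hf v hv0 rfl, mul_zero]
  have := hx _ hmem
  rw [aeval_eq_eval, map_mul, eval_X, mul_eq_zero] at this
  exact this.resolve_left hi

/-- The ideal of the cone embeds closed sets, with order strictly reversed, into the ideals of a
Noetherian ring. -/
instance noetherianSpace_pSpace : TopologicalSpace.NoetherianSpace (PSpace N) := by
  refine ((TopologicalSpace.noetherianSpace_TFAE (PSpace N)).out 0 1).2 ?_
  refine StrictAnti.wellFoundedLT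
    (f := fun Z : TopologicalSpace.Closeds (PSpace N) => vanishingIdeal ℂ (cone (Z : Set (PSpace N))))
    (Antitone.strictAnti_of_injective ?_ ?_)
  · exact fun Z Z' h => vanishingIdeal_anti_mono (cone_mono h)
  · intro Z Z' h
    refine TopologicalSpace.Closeds.ext (cone_injective ?_)
    rw [← zeroLocus_vanishingIdeal_cone Z.isClosed, ← zeroLocus_vanishingIdeal_cone Z'.isClosed]
    exact congrArg _ h

/-- An irreducible component of a subset `Z` of a Noetherian space contains a nonempty relatively
open subset of `Z`. -/
lemma exists_isOpen_inter_subset_of_isIrredComponentOf {V Z : Set (PSpace N)}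
    (h : IsIrredComponentOf V Z) :
    ∃ U : Set (PSpace N), IsOpen U ∧ (V ∩ U).Nonempty ∧ Z ∩ U ⊆ V := by
  have hV : Subtype.val '' (Subtype.val ⁻¹' V : Set Z) = V := by
    rw [Subtype.image_preimage_coe, Set.inter_eq_right.2 h.1.2]
  have hirr : ∀ T : Set Z, IsIrreducible (Subtype.val '' T) ↔ IsIrreducible T := by
    refine fun T => ⟨fun hT => ⟨hT.1.of_image, fun u v hu hv hTu hTv => ?_⟩,
      fun hT => hT.image _ continuous_subtype_val.continuousOn⟩
    obtain ⟨u, hu', rfl⟩ := isOpen_induced_iff.1 hu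
    obtain ⟨v, hv', rfl⟩ := isOpen_induced_iff.1 hv
    obtain ⟨x, hxT, hxu⟩ := hTu
    obtain ⟨y, hyT, hyv⟩ := hTv
    obtain ⟨_, ⟨z, hzT, rfl⟩, hz⟩ :=
      hT.2 u v hu' hv' ⟨x, ⟨x, hxT, rfl⟩, hxu⟩ ⟨y, ⟨y, hyT, rfl⟩, hyv⟩
    exact ⟨z, hzT, hz⟩
  have hmem : (Subtype.val ⁻¹' V : Set Z) ∈ irreducibleComponents Z := by
    refine ⟨(hirr _).1 (by rw [hV]; exact h.1.1), fun T hT hle => ?_⟩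
    have := h.2 (y := Subtype.val '' T) ⟨(hirr T).2 hT, by simp⟩
      (by rw [← hV]; exact Set.image_mono hle)
    exact Set.image_subset_iff.1 this
  obtain ⟨o, ho, hne, hsub⟩ :=
    TopologicalSpace.NoetherianSpace.exists_isOpen_nonempty_subset_irreducibleComponent _ hmem
  obtain ⟨U, hU, rfl⟩ := isOpen_induced_iff.1 ho
  obtain ⟨p, hp⟩ := hne
  exact ⟨U, hU, ⟨p, hsub hp, hp⟩, fun q hq => hsub (show (⟨q, hq.1⟩ : Z) ∈ _ from hq.2)⟩

/-! ### The vector field of an endomorphism -/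

/-- The derivation of the polynomial ring of `W` given by the linear vector field `x ↦ g x`. -/
noncomputable def linearDerivation (g : Module.End ℂ (W N)) :
    Derivation ℂ (MvPolynomial (Fin (N + 1)) ℂ) (MvPolynomial (Fin (N + 1)) ℂ) :=
  mkDerivation ℂ fun i => ∑ j, C (g (Pi.single j 1) i) * X j

lemma eval_linearDerivation_X (g : Module.End ℂ (W N)) (x : W N) (i : Fin (N + 1)) :
    eval x (linearDerivation g (X i)) = g x i := by
  rw [linearDerivation, mkDerivation_X, map_sum]
  conv_rhs => rw [pi_eq_sum_univ' x, map_sum, Finset.sum_apply]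
  refine Finset.sum_congr rfl fun j _ => ?_
  simp [mul_comm]

lemma eval_linearDerivation (g : Module.End ℂ (W N)) (x : W N)
    (f : MvPolynomial (Fin (N + 1)) ℂ) :
    eval x (linearDerivation g f) = ∑ i, eval x (pderiv i f) * g x i := by
  induction f using MvPolynomial.induction_on with
  | C a => simp
  | add p q hp hq => simp [hp, hq, add_mul, Finset.sum_add_distrib]
  | mul_X p i hp =>
    rw [Derivation.leibniz]
    simp only [smul_eq_mul, map_add, map_mul, hp, eval_linearDerivation_X, eval_X,
      Derivation.leibniz, pderiv_X, add_mul, Finset.sum_add_distrib, Finset.mul_sum]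
    congr 1
    · simp [Pi.single_apply, apply_ite]
    · exact Finset.sum_congr rfl fun _ _ => by ring

lemma mem_aut_iff {X : Set (W N)} {g : Module.End ℂ (W N)} :
    g ∈ aut X ↔ ∀ f ∈ vanishingIdeal ℂ X, ∀ y ∈ smoothPoints X,
      eval y (linearDerivation g f) = 0 := by
  simp only [eval_linearDerivation]
  exact ⟨fun h f hf y hy => h y hy f hf, fun h y hy f hf => h f hf y hy⟩

lemma mem_aut_of_forall {X : Set (W N)} {g : Module.End ℂ (W N)}
    (h : ∀ f ∈ vanishingIdeal ℂ X, linearDerivation g f ∈ vanishingIdeal ℂ X) : g ∈ aut X :=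
  mem_aut_iff.2 fun f hf y hy => mem_vanishingIdeal_iff_eval.1 (h f hf) y hy.1

/-! ### The flow of a linear vector field -/

section ExpFlow

variable {E : Type*} [NormedAddCommGroup E] [NormedSpace ℂ E]

/-- The one-parameter group of automorphisms generated by a bounded operator. -/
noncomputable def expFlow (G : E →L[ℂ] E) (t : ℂ) : E →L[ℂ] E :=
  NormedSpace.exp (t • G)

lemma expFlow_zero (G : E →L[ℂ] E) (x : E) : expFlow G 0 x = x := by
  rw [expFlow, zero_smul, NormedSpace.exp_zero, one_apply_eq_self]

variable [CompleteSpace E]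

lemma expFlow_neg_apply_expFlow (G : E →L[ℂ] E) (t : ℂ) (x : E) :
    expFlow G (-t) (expFlow G t x) = x := by
  have h : expFlow G (-t) * expFlow G t = 1 := by
    have hball (φ : E →L[ℂ] E) :
        φ ∈ Metric.eball 0 (NormedSpace.expSeries ℂ (E →L[ℂ] E)).radius :=
      (NormedSpace.expSeries_radius_eq_top ℂ (E →L[ℂ] E)).symm ▸ edist_lt_top _ _
    have hcomm : Commute (-t • G) (t • G) := by
      rw [neg_smul]
      exact (Commute.refl _).neg_left
    rw [expFlow, expFlow, ← NormedSpace.exp_add_of_commute_of_mem_ball hcomm (hball _) (hball _),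
      neg_smul, neg_add_cancel, NormedSpace.exp_zero]
  exact congrArg (fun φ : E →L[ℂ] E => φ x) h

lemma hasDerivAt_expFlow (G : E →L[ℂ] E) (x : E) (t : ℂ) :
    HasDerivAt (fun s => expFlow G s x) (G (expFlow G t x)) t := by
  have h := hasDerivAt_exp_smul_const' G t
  exact (h.clm_apply (hasDerivAt_const t x)).congr_deriv (by simp [expFlow])

end ExpFlow

/-- The one-parameter group of linear automorphisms of `W` generated by `g`. -/
noncomputable def flow (g : Module.End ℂ (W N)) (t : ℂ) : W N →ₗ[ℂ] W N :=
  expFlow (E := W N) ⟨g, g.continuous_of_finiteDimensional⟩ t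

lemma flow_zero (g : Module.End ℂ (W N)) (x : W N) : flow g 0 x = x :=
  expFlow_zero _ x

lemma flow_neg_apply_flow (g : Module.End ℂ (W N)) (t : ℂ) (x : W N) :
    flow g (-t) (flow g t x) = x :=
  expFlow_neg_apply_expFlow _ t x

lemma hasDerivAt_flow (g : Module.End ℂ (W N)) (x : W N) (t : ℂ) :
    HasDerivAt (fun s => flow g s x) (g (flow g t x)) t :=
  hasDerivAt_expFlow (E := W N) ⟨g, g.continuous_of_finiteDimensional⟩ x t

lemma hasDerivAt_eval_flow (g : Module.End ℂ (W N)) (x : W N)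
    (f : MvPolynomial (Fin (N + 1)) ℂ) (t : ℂ) :
    HasDerivAt (fun s => eval (flow g s x) f) (eval (flow g t x) (linearDerivation g f)) t := by
  induction f using MvPolynomial.induction_on with
  | C a => simpa using hasDerivAt_const t a
  | add p q hp hq =>
    simp only [map_add]
    exact hp.add hq
  | mul_X p i hp =>
    have hi : HasDerivAt (fun s => flow g s x i) (g (flow g t x) i) t :=
      hasDerivAt_pi.1 (hasDerivAt_flow g x t) i
    have := hp.mul hi
    simp only [map_mul, eval_X, Derivation.leibniz, smul_eq_mul, map_add,
      eval_linearDerivation_X]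
    exact this.congr_deriv (by ring)

lemma iteratedDeriv_eval_flow (g : Module.End ℂ (W N)) (x : W N) (n : ℕ)
    (f : MvPolynomial (Fin (N + 1)) ℂ) :
    iteratedDeriv n (fun s => eval (flow g s x) f) =
      fun s => eval (flow g s x) ((linearDerivation g)^[n] f) := by
  induction n with
  | zero => simp
  | succ n ih =>
    rw [iteratedDeriv_succ, ih]
    ext t
    rw [(hasDerivAt_eval_flow g x _ t).deriv, Function.iterate_succ_apply']

/-- The function `t ↦ f (flow g t x)` is entire, and its derivatives at 0 are the values at `x` of
the iterates of the derivation on `f`, all of which lie in the ideal of `X`. -/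
lemma eval_flow_eq_zero {X : Set (W N)} {g : Module.End ℂ (W N)}
    (h : ∀ f ∈ vanishingIdeal ℂ X, linearDerivation g f ∈ vanishingIdeal ℂ X)
    {f : MvPolynomial (Fin (N + 1)) ℂ} (hf : f ∈ vanishingIdeal ℂ X) {x : W N} (hx : x ∈ X)
    (t : ℂ) : eval (flow g t x) f = 0 := by
  have hdiff : Differentiable ℂ fun s => eval (flow g s x) f :=
    fun s => (hasDerivAt_eval_flow g x f s).differentiableAt
  have hmem : ∀ n : ℕ, (linearDerivation g)^[n] f ∈ vanishingIdeal ℂ X := by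
    intro n
    induction n with
    | zero => exact hf
    | succ n ih => rw [Function.iterate_succ_apply']; exact h _ ih
  rw [← Complex.taylorSeries_eq_of_entire (c := 0) hdiff t]
  simp only [iteratedDeriv_eval_flow, flow_zero,
    mem_vanishingIdeal_iff_eval.1 (hmem _) x hx, smul_zero, tsum_zero]

lemma flow_mem_cone {Y : Set (PSpace N)} (hY : IsClosed Y) {g : Module.End ℂ (W N)}
    (h : ∀ f ∈ vanishingIdeal ℂ (cone Y), linearDerivation g f ∈ vanishingIdeal ℂ (cone Y))
    {x : W N} (hx : x ∈ cone Y) (t : ℂ) : flow g t x ∈ cone Y := by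
  rw [← zeroLocus_vanishingIdeal_cone hY]
  intro f hf
  rw [aeval_eq_eval]
  exact eval_flow_eq_zero h hf hx t

lemma flow_ne_zero (g : Module.End ℂ (W N)) (t : ℂ) {x : W N} (hx : x ≠ 0) :
    flow g t x ≠ 0 := fun h => hx (by rw [← flow_neg_apply_flow g t x, h, map_zero])

lemma hasDerivAt_eq_zero_of_forall {F : ℂ → ℂ} {c t : ℂ} (h : HasDerivAt F c t)
    (hF : ∀ s, F s = 0) : c = 0 := by
  obtain rfl : F = fun _ => 0 := funext hF
  exact h.unique (hasDerivAt_const t 0)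

/-- A linear vector field whose flow preserves `X` preserves the ideal of `X`. -/
lemma linearDerivation_mem_of_flow_mem {X : Set (W N)} {g : Module.End ℂ (W N)}
    (h : ∀ x ∈ X, ∀ t, flow g t x ∈ X) {f : MvPolynomial (Fin (N + 1)) ℂ}
    (hf : f ∈ vanishingIdeal ℂ X) : linearDerivation g f ∈ vanishingIdeal ℂ X := by
  rw [mem_vanishingIdeal_iff_eval] at hf ⊢
  intro x hx
  have h1 := hasDerivAt_eq_zero_of_forall (hasDerivAt_eval_flow g x f 0)
    fun s => hf _ (h x hx s)
  rwa [flow_zero] at h1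

/-! ### The smooth locus -/

lemma comap_algEquiv_mem_smoothLocus {A B : Type*} [CommRing A] [CommRing B] [Algebra ℂ A]
    [Algebra ℂ B] (e : A ≃ₐ[ℂ] B) {p : PrimeSpectrum B} (hp : p ∈ Algebra.smoothLocus ℂ B) :
    PrimeSpectrum.comap (e : A →+* B) p ∈ Algebra.smoothLocus ℂ A := by
  let : Algebra A B := (e : A →+* B).toAlgebra
  have : IsScalarTower ℂ A B := IsScalarTower.of_algebraMap_eq fun r => (e.commutes r).symm
  -- An isomorphism is a localization away from 1, so the compatibility of smooth loci with
  -- localization applies.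
  have : IsLocalization.Away (1 : A) B :=
    IsLocalization.away_of_isUnit_of_bijective B isUnit_one e.bijective
  rw [← Algebra.smoothLocus_comap_of_isLocalization (Af := B) (1 : A)] at hp
  exact hp

/-- Composition of polynomial functions on `W` with a linear endomorphism. -/
noncomputable def linearSubst (φ : W N →ₗ[ℂ] W N) :
    MvPolynomial (Fin (N + 1)) ℂ →ₐ[ℂ] MvPolynomial (Fin (N + 1)) ℂ :=
  aeval fun i => ∑ j, C (φ (Pi.single j 1) i) * X j

lemma eval_linearSubst (φ : W N →ₗ[ℂ] W N) (x : W N) (f : MvPolynomial (Fin (N + 1)) ℂ) :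
    eval x (linearSubst φ f) = eval (φ x) f := by
  have hX : ∀ i, eval x (∑ j, C (φ (Pi.single j 1) i) * X j) = φ x i := by
    intro i
    rw [map_sum]
    conv_rhs => rw [pi_eq_sum_univ' x, map_sum, Finset.sum_apply]
    exact Finset.sum_congr rfl fun j _ => by simp [mul_comm]
  induction f using MvPolynomial.induction_on with
  | C a => simp [linearSubst]
  | add p q hp hq => simp [hp, hq]
  | mul_X p i hp =>
    rw [map_mul, map_mul, hp, map_mul, eval_X]
    simp only [linearSubst, aeval_X, hX]

/-- Composition with a linear automorphism, as an automorphism of the polynomial ring. -/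
noncomputable def linearSubstEquiv (φ : W N ≃ₗ[ℂ] W N) :
    MvPolynomial (Fin (N + 1)) ℂ ≃ₐ[ℂ] MvPolynomial (Fin (N + 1)) ℂ :=
  AlgEquiv.ofAlgHom (linearSubst φ.toLinearMap) (linearSubst φ.symm.toLinearMap)
    (AlgHom.ext fun f => MvPolynomial.funext fun x => by simp [eval_linearSubst])
    (AlgHom.ext fun f => MvPolynomial.funext fun x => by simp [eval_linearSubst])

lemma eval_linearSubstEquiv (φ : W N ≃ₗ[ℂ] W N) (x : W N) (f : MvPolynomial (Fin (N + 1)) ℂ) :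
    eval x (linearSubstEquiv φ f) = eval (φ x) f :=
  eval_linearSubst φ.toLinearMap x f

lemma isSmoothPoint_map {X : Set (W N)} (φ : W N ≃ₗ[ℂ] W N) (hφ : ∀ x, φ x ∈ X ↔ x ∈ X)
    {x : W N} (hx : IsSmoothPoint X x) : IsSmoothPoint X (φ x) := by
  obtain ⟨p, hpx, hp⟩ := hx
  have hmem : ∀ f, linearSubstEquiv φ f ∈ vanishingIdeal ℂ X ↔ f ∈ vanishingIdeal ℂ X := by
    intro f
    simp only [mem_vanishingIdeal_iff_eval, eval_linearSubstEquiv]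
    refine ⟨fun h y hy => ?_, fun h y hy => h _ ((hφ y).2 hy)⟩
    have := h (φ.symm y) ((hφ _).1 (by simpa using hy))
    rwa [φ.apply_symm_apply] at this
  have hmap : vanishingIdeal ℂ X = (vanishingIdeal ℂ X).map
      (linearSubstEquiv φ : MvPolynomial (Fin (N + 1)) ℂ →+* MvPolynomial (Fin (N + 1)) ℂ) := by
    refine le_antisymm (fun f hf => ?_) (Ideal.map_le_iff_le_comap.2 fun f hf => (hmem f).2 hf)
    rw [← (linearSubstEquiv φ).apply_symm_apply f] at hf ⊢
    exact Ideal.mem_map_of_mem _ ((hmem _).1 hf)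
  -- Composition with `φ` descends to the coordinate ring; pulling back along it sends the maximal
  -- ideal of `x` to that of `φ x`.
  let e : CoordRing X ≃ₐ[ℂ] CoordRing X :=
    Ideal.quotientEquivAlg _ _ (linearSubstEquiv φ) hmap
  refine ⟨PrimeSpectrum.comap (e : CoordRing X →+* CoordRing X) p, ?_,
    comap_algEquiv_mem_smoothLocus e hp⟩
  ext f
  have h2 : linearSubstEquiv φ f ∈ (PrimeSpectrum.comap
      (Ideal.Quotient.mk (vanishingIdeal ℂ X)) p).asIdeal ↔ eval x (linearSubstEquiv φ f) = 0 := by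
    rw [hpx]
    simp [pointToPoint, aeval_eq_eval]
  rw [eval_linearSubstEquiv] at h2
  refine Iff.trans ?_ (h2.trans ?_)
  · rfl
  · simp [pointToPoint, aeval_eq_eval]

/-- Minimal primes of a reduced algebra of finite type over `ℂ` lie in the smooth locus. -/
lemma mem_smoothLocus_of_mem_minimalPrimes {A : Type*} [CommRing A] [Algebra ℂ A] [IsReduced A]
    [Algebra.FiniteType ℂ A] {p : PrimeSpectrum A} (hp : p.asIdeal ∈ minimalPrimes A) :
    p ∈ Algebra.smoothLocus ℂ A := by
  -- The maximal ideal of the local ring at a minimal prime is its nilradical, which is zero since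
  -- `A` is reduced. The local ring is thus a field, essentially of finite type over the perfect
  -- field `ℂ`, hence formally smooth.
  have hfield : IsField (Localization.AtPrime p.asIdeal) := by
    have h := IsLocalization.AtPrime.radical_map_of_mem_minimalPrimes
      (A := Localization.AtPrime p.asIdeal) p.asIdeal ⊥ hp
    rw [IsLocalRing.isField_iff_maximalIdeal_eq, ← Localization.AtPrime.map_eq_maximalIdeal, ← h,
      Ideal.map_bot]
    exact nilradical_eq_zero _
  let := hfield.toField
  have : Algebra.EssFiniteType A (Localization.AtPrime p.asIdeal) :=
    .of_isLocalization _ p.asIdeal.primeCompl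
  have : Algebra.EssFiniteType ℂ (Localization.AtPrime p.asIdeal) := .comp _ A _
  exact Algebra.FormallySmooth.of_perfectField (K := ℂ) (L := Localization.AtPrime p.asIdeal)

/-- The smooth points of an affine variety are dense. -/
lemma mem_vanishingIdeal_of_smoothPoints {X : Set (W N)}
    (hX : zeroLocus ℂ (vanishingIdeal ℂ X) = X) {f : MvPolynomial (Fin (N + 1)) ℂ}
    (hf : ∀ x ∈ smoothPoints X, eval x f = 0) : f ∈ vanishingIdeal ℂ X := by
  have hrad : (vanishingIdeal ℂ X).IsRadical := by
    rw [← hX, vanishingIdeal_zeroLocus_eq_radical]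
    exact Ideal.radical_isRadical _
  have : IsReduced (CoordRing X) := (Ideal.isRadical_iff_quotient_reduced _).1 hrad
  have : Algebra.FinitePresentation ℂ (CoordRing X) :=
    Algebra.FinitePresentation.of_finiteType.1 inferInstance
  by_contra hcon
  have hne : Ideal.Quotient.mk (vanishingIdeal ℂ X) f ≠ 0 := by
    rwa [Ne, Ideal.Quotient.eq_zero_iff_mem]
  -- In a reduced ring the minimal primes intersect in zero, so some minimal prime avoids `f`; it
  -- witnesses that the smooth locus meets the basic open set of `f`.
  obtain ⟨p, hp, hfp⟩ : ∃ p ∈ minimalPrimes (CoordRing X),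
      Ideal.Quotient.mk (vanishingIdeal ℂ X) f ∉ p := by
    by_contra! hall
    refine hne ?_
    have : Ideal.Quotient.mk (vanishingIdeal ℂ X) f ∈ sInf (minimalPrimes (CoordRing X)) :=
      Ideal.mem_sInf.2 fun {I} hI => hall I hI
    rw [minimalPrimes, Ideal.sInf_minimalPrimes] at this
    exact (Submodule.mem_bot _).1 ((nilradical_eq_zero (CoordRing X)).le this)
  have hne' : (Algebra.smoothLocus ℂ (CoordRing X) ∩ (PrimeSpectrum.basicOpen
      (Ideal.Quotient.mk (vanishingIdeal ℂ X) f) : Set (PrimeSpectrum (CoordRing X)))).Nonempty :=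
    ⟨⟨p, hp.1.1⟩, mem_smoothLocus_of_mem_minimalPrimes hp, hfp⟩
  have : JacobsonSpace (PrimeSpectrum (CoordRing X)) :=
    PrimeSpectrum.isJacobsonRing_iff_jacobsonSpace.1 inferInstance
  -- The coordinate ring is Jacobson, so this nonempty open set contains a closed point, which by
  -- the Nullstellensatz is a point `x` of `X` with `f x ≠ 0`.
  obtain ⟨m, ⟨hms, hmf⟩, hm⟩ := nonempty_inter_closedPoints hne'
    (Algebra.isOpen_smoothLocus.inter (PrimeSpectrum.isOpen_basicOpen)).isLocallyClosed
  have hmax : m.asIdeal.IsMaximal := (PrimeSpectrum.isClosed_singleton_iff_isMaximal m).1 hm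
  have hmax' : (m.asIdeal.comap (Ideal.Quotient.mk (vanishingIdeal ℂ X))).IsMaximal :=
    Ideal.comap_isMaximal_of_surjective _ Ideal.Quotient.mk_surjective
  obtain ⟨x, hx⟩ := isMaximal_iff_eq_vanishingIdeal_singleton.1 hmax'
  have hxm : ∀ g, Ideal.Quotient.mk (vanishingIdeal ℂ X) g ∈ m.asIdeal ↔ eval x g = 0 := by
    intro g
    rw [← Ideal.mem_comap, hx]
    simp [aeval_eq_eval]
  refine hmf ((hxm f).2 (hf x ⟨?_, m, PrimeSpectrum.ext hx, hms⟩))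
  rw [← hX]
  intro g hg
  rw [aeval_eq_eval]
  refine (hxm g).1 ?_
  rw [Ideal.Quotient.eq_zero_iff_mem.2 hg]
  exact zero_mem _

lemma linearDerivation_mem_of_mem_aut {Y : Set (PSpace N)} (hY : IsClosed Y)
    {g : Module.End ℂ (W N)} (hg : g ∈ aut (cone Y)) {f : MvPolynomial (Fin (N + 1)) ℂ}
    (hf : f ∈ vanishingIdeal ℂ (cone Y)) :
    linearDerivation g f ∈ vanishingIdeal ℂ (cone Y) :=
  mem_vanishingIdeal_of_smoothPoints (zeroLocus_vanishingIdeal_cone hY) (mem_aut_iff.1 hg f hf)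

/-- The flow of an infinitesimal automorphism of a cone preserves the cone of the singular locus. -/
lemma flow_mem_cone_singularLocus {Y : Set (PSpace N)} (hY : IsClosed Y)
    {g : Module.End ℂ (W N)} (hg : g ∈ aut (cone Y)) {x : W N}
    (hx : x ∈ cone (singularLocus Y)) (t : ℂ) : flow g t x ∈ cone (singularLocus Y) := by
  have hflow : ∀ s, ∀ y ∈ cone Y, flow g s y ∈ cone Y := fun s y hy =>
    flow_mem_cone hY (fun f hf => linearDerivation_mem_of_mem_aut hY hg hf) hy s
  intro h0
  have hx0 : x ≠ 0 := fun h => h0 (by rw [h, map_zero])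
  obtain ⟨hxY, w, hw0, hwx, hw⟩ := hx hx0
  have hwY : w ∈ cone Y := fun _ => hwx ▸ hxY
  let φ : W N ≃ₗ[ℂ] W N := LinearEquiv.ofLinearMap (flow g t) (flow g (-t))
    (LinearMap.ext fun y => by simpa using flow_neg_apply_flow g (-t) y)
    (LinearMap.ext fun y => flow_neg_apply_flow g t y)
  have hφ : ∀ y, φ.symm y ∈ cone Y ↔ y ∈ cone Y := fun y =>
    ⟨fun h => φ.apply_symm_apply y ▸ hflow t _ h, hflow (-t) y⟩
  refine ⟨hflow t x (fun _ => hxY) h0, flow g t w, flow_ne_zero g t hw0, ?_, fun hs => hw ?_⟩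
  · obtain ⟨a, rfl⟩ := (Projectivization.mk_eq_mk_iff ℂ _ _ _ _).1 hwx
    exact (Projectivization.mk_eq_mk_iff ℂ _ _ _ _).2 ⟨a, ((flow g t).map_smul (a : ℂ) x).symm⟩
  -- Were the moved point smooth, the inverse automorphism would carry smoothness back to `w`.
  · refine ⟨hwY, ?_⟩
    have := isSmoothPoint_map φ.symm hφ hs.2
    rwa [show φ.symm (flow g t w) = w from flow_neg_apply_flow g t w] at this

/-- A linear vector field which preserves a subset of `ℙ^N` preserves its irreducible components. -/
lemma linearDerivation_mem_of_isIrredComponentOf {V Z : Set (PSpace N)} (hV : IsIrreducible V)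
    (hcomp : IsIrredComponentOf V Z) {g : Module.End ℂ (W N)}
    (hg : ∀ f ∈ vanishingIdeal ℂ (cone Z), linearDerivation g f ∈ vanishingIdeal ℂ (cone Z))
    {f : MvPolynomial (Fin (N + 1)) ℂ} (hf : f ∈ vanishingIdeal ℂ (cone V)) :
    linearDerivation g f ∈ vanishingIdeal ℂ (cone V) := by
  obtain ⟨U, hU, hne, hsub⟩ := exists_isOpen_inter_subset_of_isIrredComponentOf hcomp
  obtain ⟨S, hS, hSU⟩ := (isClosed_iff_isAlgebraicSet _).1 hU.isClosed_compl
  rw [mem_vanishingIdeal_iff_eval] at hf ⊢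
  have hdense : V ⊆ closure (V ∩ U) := subset_closure_inter_of_isPreirreducible_of_isOpen hV.2 hU hne
  refine fun w hw => eval_eq_zero_of_mem_cone_closure (T := V ∩ U) ?_ (cone_mono hdense hw)
  clear w hw
  intro w hw
  rcases eq_or_ne w 0 with rfl | hw0
  · rw [eval_linearDerivation, map_zero]
    simp
  have hwV : w ∈ cone V := fun h => (hw h).1
  have hwU : Projectivization.mk ℂ w hw0 ∉ projZeroLocus N S := by
    rw [← hSU]
    exact fun h => h (hw hw0).2
  simp only [projZeroLocus, Set.mem_ofPred_eq, not_forall] at hwU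
  -- The form `h` vanishes off `U` but not at `w`. Since `Z ∩ U ⊆ V`, the product `h * f` vanishes
  -- on all of `Z`.
  obtain ⟨h, hhS, v, hv0, hvw, hhv⟩ := hwU
  obtain ⟨d, hd⟩ := hS h hhS
  have hhw : eval w h ≠ 0 := fun h0 => hhv ((eval_eq_zero_iff_of_mk_eq hd hv0 hw0 hvw).2 h0)
  have hmem : h * f ∈ vanishingIdeal ℂ (cone Z) := by
    rw [mem_vanishingIdeal_iff_eval]
    intro y hy
    rw [map_mul, mul_eq_zero]
    rcases eq_or_ne y 0 with rfl | hy0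
    · exact Or.inr (hf 0 (zero_mem_cone V))
    by_cases hyU : Projectivization.mk ℂ y hy0 ∈ U
    · exact Or.inr (hf y fun _ => hsub ⟨hy hy0, hyU⟩)
    · have : Projectivization.mk ℂ y hy0 ∈ Uᶜ := hyU
      rw [hSU] at this
      exact Or.inl (this h hhS y hy0 rfl)
  have hD := mem_vanishingIdeal_iff_eval.1 (hg _ hmem) w (cone_mono hcomp.1.2 hwV)
  -- At `w` the term of the product rule containing `f w` drops out, leaving `h w` times the value
  -- sought.
  rw [Derivation.leibniz, map_add, smul_eq_mul, smul_eq_mul, map_mul, map_mul, hf w hwV,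
    zero_mul, add_zero] at hD
  exact (mul_eq_zero.1 hD).resolve_left hhw

/-! ### The secant variety -/

/-- The hypothesis `V ⊆ secantVariety V` covers the degenerate sums, where a summand is zero or the
two are proportional and no secant line is defined. -/
lemma add_mem_cone_secantVariety {V : Set (PSpace N)} (hV : V ⊆ secantVariety V) {u v : W N}
    (hu : u ∈ cone V) (hv : v ∈ cone V) : u + v ∈ cone (secantVariety V) := by
  rcases eq_or_ne u 0 with rfl | hu0
  · rw [zero_add]
    exact cone_mono hV hv
  rcases eq_or_ne v 0 with rfl | hv0
  · rw [add_zero]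
    exact cone_mono hV hu
  by_cases hp : Projectivization.mk ℂ u hu0 = Projectivization.mk ℂ v hv0
  · obtain ⟨a, rfl⟩ := (Projectivization.mk_eq_mk_iff ℂ _ _ _ _).1 hp
    have : a • v + v = ((a : ℂ) + 1) • v := by rw [add_smul, one_smul]; rfl
    rw [this]
    exact smul_mem_cone (cone_mono hV hv) _
  · intro h0
    refine subset_closure ⟨_, hu hu0, _, hv hv0, hp, ?_⟩
    simp only [line, Set.mem_ofPred_eq, Projectivization.submodule_mk,
      Submodule.span_singleton_le_iff_mem]
    exact Submodule.add_mem_sup (Submodule.mem_span_singleton_self u)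
      (Submodule.mem_span_singleton_self v)

/-- The cone over `V` absorbs scalars, so plain sums already fill the secant lines; the rest is
closure. -/
lemma mem_vanishingIdeal_cone_secantVariety {V : Set (PSpace N)}
    {f : MvPolynomial (Fin (N + 1)) ℂ}
    (hf : ∀ u ∈ cone V, ∀ v ∈ cone V, eval (u + v) f = 0) :
    f ∈ vanishingIdeal ℂ (cone (secantVariety V)) := by
  rw [mem_vanishingIdeal_iff_eval]
  refine fun w hw => eval_eq_zero_of_mem_cone_closure ?_ hw
  clear w hw
  intro w hw
  rcases eq_or_ne w 0 with rfl | hw0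
  · simpa using hf 0 (zero_mem_cone V) 0 (zero_mem_cone V)
  obtain ⟨p, hp, q, hq, -, hl⟩ := hw hw0
  rw [line, Set.mem_ofPred_eq, Projectivization.submodule_mk,
    Submodule.span_singleton_le_iff_mem, Submodule.mem_sup] at hl
  obtain ⟨u, hu, v, hv, rfl⟩ := hl
  exact hf u (mem_cone_of_mem_submodule hp hu) v (mem_cone_of_mem_submodule hq hv)

/-- Translation of polynomial functions on `W`. -/
noncomputable def translate (v : W N) :
    MvPolynomial (Fin (N + 1)) ℂ →ₐ[ℂ] MvPolynomial (Fin (N + 1)) ℂ :=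
  aeval fun i => X i + C (v i)

lemma eval_translate (v x : W N) (f : MvPolynomial (Fin (N + 1)) ℂ) :
    eval x (translate v f) = eval (x + v) f := by
  induction f using MvPolynomial.induction_on with
  | C a => simp [translate]
  | add p q hp hq => simp [hp, hq]
  | mul_X p i hp =>
    rw [map_mul, map_mul, hp, map_mul, eval_X]
    simp [translate]

lemma pderiv_translate (v : W N) (i : Fin (N + 1)) (f : MvPolynomial (Fin (N + 1)) ℂ) :
    pderiv i (translate v f) = translate v (pderiv i f) := by
  induction f using MvPolynomial.induction_on with
  | C a => simp [translate]
  | add p q hp hq => simp [hp, hq]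
  | mul_X p j hp =>
    have hX : pderiv i (translate v (X j)) = translate v (pderiv i (X j)) := by
      simp [translate, pderiv_X, Pi.single_apply, apply_ite]
    simp only [map_mul, Derivation.leibniz, map_add, hp, hX, smul_eq_mul]

/-- A linear vector field tangent to the cone over `V` is tangent to the cone over the secant
variety of `V`. -/
lemma linearDerivation_mem_secantVariety {V : Set (PSpace N)} (hV : V ⊆ secantVariety V)
    {g : Module.End ℂ (W N)}
    (hg : ∀ f ∈ vanishingIdeal ℂ (cone V), linearDerivation g f ∈ vanishingIdeal ℂ (cone V))
    {f : MvPolynomial (Fin (N + 1)) ℂ} (hf : f ∈ vanishingIdeal ℂ (cone (secantVariety V))) :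
    linearDerivation g f ∈ vanishingIdeal ℂ (cone (secantVariety V)) := by
  have key : ∀ u ∈ cone V, ∀ v ∈ cone V, ∑ i, eval (u + v) (pderiv i f) * g u i = 0 := by
    intro u hu v hv
    -- With `v` fixed, an equation of the secant cone becomes an equation, usually inhomogeneous, of
    -- the cone over `V`, to which `hg` applies.
    have hmem : translate v f ∈ vanishingIdeal ℂ (cone V) :=
      mem_vanishingIdeal_iff_eval.2 fun x hx => by
        rw [eval_translate]
        exact mem_vanishingIdeal_iff_eval.1 hf _ (add_mem_cone_secantVariety hV hx hv)
    have := mem_vanishingIdeal_iff_eval.1 (hg _ hmem) u hu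
    simpa only [eval_linearDerivation, pderiv_translate, eval_translate] using this
  refine mem_vanishingIdeal_cone_secantVariety fun u hu v hv => ?_
  rw [eval_linearDerivation, map_add]
  simp only [Pi.add_apply, mul_add, Finset.sum_add_distrib]
  rw [key u hu v hv, add_comm u v, key v hv u hu, add_zero]

lemma linearDerivation_mem_of_singularLocus_eq_empty {V : Set (PSpace N)}
    (hsmooth : singularLocus V = ∅) {g : Module.End ℂ (W N)} (hg : g ∈ aut (cone V))
    {f : MvPolynomial (Fin (N + 1)) ℂ} (hf : f ∈ vanishingIdeal ℂ (cone V)) :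
    linearDerivation g f ∈ vanishingIdeal ℂ (cone V) := by
  rw [mem_vanishingIdeal_iff_eval]
  intro w hw
  rcases eq_or_ne w 0 with rfl | hw0
  -- Smoothness of `V` says nothing about the vertex of its cone, but a linear vector field vanishes
  -- there.
  · rw [eval_linearDerivation, map_zero]
    simp
  refine mem_aut_iff.1 hg f hf w ?_
  by_contra hs
  exact Set.eq_empty_iff_forall_notMem.1 hsmooth _ ⟨hw hw0, w, hw0, rfl, hs⟩

theorem aut_cone_secantVariety {V : Set (PSpace N)} (hirr : IsIrreducible V)
    (hsmooth : singularLocus V = ∅)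
    (hcomp : IsIrredComponentOf V (singularLocus (secantVariety V))) :
    aut (cone (secantVariety V)) = aut (cone V) := by
  have hV : V ⊆ secantVariety V := fun p hp => (hcomp.1.2 hp).1
  have hY : IsClosed (secantVariety V) := isClosed_closure
  refine le_antisymm (fun g hg => mem_aut_of_forall fun f hf => ?_)
    (fun g hg => mem_aut_of_forall fun f hf => ?_)
  · exact linearDerivation_mem_of_isIrredComponentOf hirr hcomp (fun h hh =>
      linearDerivation_mem_of_flow_mem (fun x hx t => flow_mem_cone_singularLocus hY hg hx t) hh) hf
  · exact linearDerivation_mem_secantVariety hV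
      (fun h hh => linearDerivation_mem_of_singularLocus_eq_empty hsmooth hg hh) hf

end SecantAut

theorem proposition3p8 (N : ℕ) (V : Set (SecantAut.PSpace N))
    (hclosed : IsClosed V) (hirr : IsIrreducible V)
    (hsmooth : SecantAut.singularLocus V = ∅)
    (hcomp : SecantAut.IsIrredComponentOf V
      (SecantAut.singularLocus (SecantAut.secantVariety V))) :
    SecantAut.aut (SecantAut.cone (SecantAut.secantVariety V)) =
        SecantAut.aut (SecantAut.cone V) ∧
      SecantAut.prolongation (SecantAut.aut (SecantAut.cone (SecantAut.secantVariety V))) =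
        SecantAut.prolongation (SecantAut.aut (SecantAut.cone V)) := by
  have h := SecantAut.aut_cone_secantVariety hirr hsmooth hcomp
  exact ⟨h, by rw [h]⟩
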